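/- Let $\mathbf k$ be a field. Let $V$ be a $\mathbf k$-vector space and let $\mathcal T_{ns}(V)$ be the free nonsymmetric operad on $V$ placed in arity $2$: $\mathcal T_{ns}(V)(n)=\bigoplus_t t[V]$, the sum over planar binary trees $t$ with $n$ leaves, where $t[V]=\bigotimes_{v} V$ over the internal vertices $v$ of $t$. A *binary quadratic nonsymmetric operad* is a quotient $\mathcal P=\mathcal T_{ns}(V)/(R)$ by the operadic ideal generated by a subspace $R\subseteq\mathcal T_{ns}(V)(3)$; it is considered together with its presentation $(V,R)$. *Bisuccessor.* Put $\widetilde V=V\otimes(\mathbf k{\prec}\oplus\mathbf k{\succ})$ and $\star={\prec}+{\succ}$. For a planar binary tree $\tau$ with vertices decorated by elements of $V$ and a leaf $x$ of $\tau$, let $\mathrm{Su}_x(\tau)$ be obtained recursively as follows. It is the trivial tree if $\tau$ is trivial. If $\tau=\tau_\ell\vee_\omega\tau_r$ (root label $\omega$), then $\mathrm{Su}_x(\tau)=\mathrm{Su}_x(\tau_\ell)\vee_{\omega\otimes\prec}\widetilde{\tau_r}$ if $x$ is a leaf of $\tau_\ell$, and $\mathrm{Su}_x(\tau)=\widetilde{\tau_\ell}\vee_{\omega\otimes\succ}\mathrm{Su}_x(\tau_r)$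 if $x$ is a leaf of $\tau_r$, where $\widetilde{\ \cdot\ }$ replaces every label $\omega$ by $\omega\otimes\star$. Extend $\mathrm{Su}_x$ linearly, for $x$ the $i$-th leaf, to $\mathcal T_{ns}(V)(n)\to\mathcal T_{ns}(\widetilde V)(n)$. Then $\mathrm{Su}(\mathcal P)=\mathcal T_{ns}(\widetilde V)/(\mathrm{Su}(R))$, where $\mathrm{Su}(R)$ is spanned by all $\mathrm{Su}_x(r)$, $r\in R$, $x$ a leaf. *Black square product.* For $\mathcal P=\mathcal T_{ns}(V)/(R)$ and $\mathcal Q=\mathcal T_{ns}(W)/(S)$ binary quadratic, $\mathcal P\,\blacksquare\,\mathcal Q=\mathcal T_{ns}(V\otimes W)/(\Psi(R\otimes S))$, where $\Psi:\mathcal T_{ns}(V)(3)\otimes\mathcal T_{ns}(W)(3)\to\mathcal T_{ns}(V\otimes W)(3)$ is the linear map with $$(a\circ_1 b)\otimes(a'\circ_1 b')\mapsto (a\otimes a')\circ_1(b\otimes b'),\qquad (a\circ_2 b)\otimes(a'\circ_2 b')\mapsto-(a\otimes a')\circ_2(b\otimes b'),$$ and which sends $(a\circ_1 b)\otimes(a'\circ_2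 b')$ and $(a\circ_2 b)\otimes(a'\circ_1 b')$ to $0$. *Dendriform operad.* $\mathit{Dend}$ is generated by two binary operations $\prec,\succ$ with relations $(x\prec y)\prec z=x\prec(y\star z)$, $(x\succ y)\prec z=x\succ(y\prec z)$, $(x\star y)\succ z=x\succ(y\succ z)$, where $\star={\prec}+{\succ}$. **Theorem.** For every binary quadratic nonsymmetric operad $\mathcal P$ there is an isomorphism of nonsymmetric operads $$\mathrm{Su}(\mathcal P)\;\cong\;\mathit{Dend}\ \blacksquare\ \mathcal P .$$ -/

import Mathlib

open scoped TensorProduct DirectSum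

noncomputable section

set_option linter.unusedSectionVars false
set_option linter.unusedVariables false

namespace NSOp

universe u v w

/-! ### Nonsymmetric operads, ideals, quotients, isomorphisms -/

/-- A nonsymmetric `k`-linear operad, in terms of partial compositions.
`comp i h a b` is `a ∘ᵢ b` (the output of `b` is plugged into the `i`-th input of `a`, inputs being
numbered from `0`); the arity of the result is `m + n - 1`, which is recorded by the equation `h`
so that no casts are needed. -/
structure NsOperad (k : Type u) [Field k] where
  obj : ℕ → Type v
  [addCommGroup : ∀ n, AddCommGroup (obj n)]
  [module : ∀ n, Module k (obj n)]
  one : obj 1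
  comp : ∀ {m n l : ℕ} (_ : Fin m) (_ : m + n = l + 1), obj m →ₗ[k] obj n →ₗ[k] obj l
  one_comp : ∀ {n : ℕ} (i : Fin 1) (h : 1 + n = n + 1) (a : obj n), comp i h one a = a
  comp_one : ∀ {n : ℕ} (i : Fin n) (h : n + 1 = n + 1) (a : obj n), comp i h a one = a
  /-- Sequential axiom: `(a ∘ᵢ b) ∘ᵢ₊ⱼ c = a ∘ᵢ (b ∘ⱼ c)`. -/
  comp_seq : ∀ {m n p r s t : ℕ} (i : Fin m) (j : Fin n) (q : Fin r) (_ : (q : ℕ) = i + j)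
    (h₁ : m + n = r + 1) (h₂ : r + p = t + 1) (h₃ : n + p = s + 1) (h₄ : m + s = t + 1)
    (a : obj m) (b : obj n) (c : obj p),
    comp q h₂ (comp i h₁ a b) c = comp i h₄ a (comp j h₃ b c)
  /-- Parallel axiom: `(a ∘ᵢ b) ∘ⱼ₋₁₊ₙ c = (a ∘ⱼ c) ∘ᵢ b` for `i < j`, `n` the arity of `b`. -/
  comp_par : ∀ {m n p r s t : ℕ} (i j : Fin m) (_ : i < j) (q : Fin r) (i' : Fin s)
    (_ : (q : ℕ) + 1 = j + n) (_ : (i' : ℕ) = i)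
    (h₁ : m + n = r + 1) (h₂ : r + p = t + 1) (h₃ : m + p = s + 1) (h₄ : s + n = t + 1)
    (a : obj m) (b : obj n) (c : obj p),
    comp q h₂ (comp i h₁ a b) c = comp i' h₄ (comp j h₃ a c) b

attribute [instance] NsOperad.addCommGroup NsOperad.module

namespace NsOperad

variable {k : Type u} [Field k]

/-- An isomorphism of nonsymmetric operads. -/
structure Iso (P : NsOperad.{u, v} k) (Q : NsOperad.{u, w} k) where
  equiv : ∀ n, P.obj n ≃ₗ[k] Q.obj n
  map_one : equiv 1 P.one = Q.one
  map_comp : ∀ {m n l : ℕ} (i : Fin m) (h : m + n = l + 1) (a : P.obj m) (b : P.obj n),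
    equiv l (P.comp i h a b) = Q.comp i h (equiv m a) (equiv n b)

variable (P : NsOperad.{u, v} k)

/-- An operadic ideal: a family of subspaces that absorbs partial compositions on both sides. -/
structure Ideal where
  carrier : ∀ n, Submodule k (P.obj n)
  comp_left_mem : ∀ {m n l : ℕ} (i : Fin m) (h : m + n = l + 1) (a : P.obj m) (b : P.obj n),
    a ∈ carrier m → P.comp i h a b ∈ carrier l
  comp_right_mem : ∀ {m n l : ℕ} (i : Fin m) (h : m + n = l + 1) (a : P.obj m) (b : P.obj n),
    b ∈ carrier n → P.comp i h a b ∈ carrier l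

/-- The operadic ideal generated by a family of subspaces: the smallest ideal containing it. -/
def idealSpan (R : ∀ n, Submodule k (P.obj n)) : P.Ideal where
  carrier n := ⨅ J : {J : P.Ideal // ∀ m, R m ≤ J.carrier m}, J.1.carrier n
  comp_left_mem i h a b ha := by
    simp only [Submodule.mem_iInf] at ha ⊢
    exact fun J => J.1.comp_left_mem i h a b (ha J)
  comp_right_mem i h a b hb := by
    simp only [Submodule.mem_iInf] at hb ⊢
    exact fun J => J.1.comp_right_mem i h a b (hb J)

/-- Partial composition in the quotient of an operad by an ideal. -/
def quotientComp (I : P.Ideal) {m n l : ℕ} (i : Fin m) (h : m + n = l + 1) :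
    (P.obj m ⧸ I.carrier m) →ₗ[k] (P.obj n ⧸ I.carrier n) →ₗ[k] (P.obj l ⧸ I.carrier l) :=
  LinearMap.liftQ₂ (I.carrier m) (I.carrier n)
    ((P.comp i h).compr₂ (I.carrier l).mkQ)
    (fun a ha => by
      ext b
      simpa using I.comp_left_mem i h a b ha)
    (fun b hb => by
      ext a
      simpa using I.comp_right_mem i h a b hb)

lemma quotientComp_mk (I : P.Ideal) {m n l : ℕ} (i : Fin m) (h : m + n = l + 1)
    (a : P.obj m) (b : P.obj n) :
    P.quotientComp I i h (Submodule.Quotient.mk a) (Submodule.Quotient.mk b) =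
      Submodule.Quotient.mk (P.comp i h a b) := rfl

/-- The quotient of a nonsymmetric operad by an operadic ideal. -/
def quotient (I : P.Ideal) : NsOperad.{u, v} k where
  obj n := P.obj n ⧸ I.carrier n
  one := Submodule.Quotient.mk P.one
  comp i h := P.quotientComp I i h
  one_comp i h a := by
    obtain ⟨a, rfl⟩ := Submodule.Quotient.mk_surjective _ a
    rw [quotientComp_mk, P.one_comp]
  comp_one i h a := by
    obtain ⟨a, rfl⟩ := Submodule.Quotient.mk_surjective _ a
    rw [quotientComp_mk, P.comp_one]
  comp_seq i j q hq h₁ h₂ h₃ h₄ a b c := by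
    obtain ⟨a, rfl⟩ := Submodule.Quotient.mk_surjective _ a
    obtain ⟨b, rfl⟩ := Submodule.Quotient.mk_surjective _ b
    obtain ⟨c, rfl⟩ := Submodule.Quotient.mk_surjective _ c
    simp only [quotientComp_mk]
    rw [P.comp_seq i j q hq h₁ h₂ h₃ h₄]
  comp_par i j hij q i' hq hi h₁ h₂ h₃ h₄ a b c := by
    obtain ⟨a, rfl⟩ := Submodule.Quotient.mk_surjective _ a
    obtain ⟨b, rfl⟩ := Submodule.Quotient.mk_surjective _ b
    obtain ⟨c, rfl⟩ := Submodule.Quotient.mk_surjective _ c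
    simp only [quotientComp_mk]
    rw [P.comp_par i j hij q i' hq hi h₁ h₂ h₃ h₄]

end NsOperad

/-! ### Planar binary trees -/

/-- Planar binary rooted trees, including the trivial tree. -/
inductive PTree : Type
  | leaf : PTree
  | node : PTree → PTree → PTree
  deriving DecidableEq

namespace PTree

/-- The number of leaves. -/
def numLeaves : PTree → ℕ
  | leaf => 1
  | node l r => numLeaves l + numLeaves r

lemma numLeaves_leaf : leaf.numLeaves = 1 := rfl

/-- The set of internal vertices of a tree. -/
inductive Vert : PTree → Type
  | root {l r : PTree} : Vert (node l r)
  | inl {l r : PTree} : Vert l → Vert (node l r)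
  | inr {l r : PTree} : Vert r → Vert (node l r)

/-- The set of leaves of a tree. -/
inductive Leaf : PTree → Type
  | triv : Leaf leaf
  | inl {l r : PTree} : Leaf l → Leaf (node l r)
  | inr {l r : PTree} : Leaf r → Leaf (node l r)

/-- The position of a leaf, counted from left to right starting at `0`. -/
def Leaf.pos : {t : PTree} → Leaf t → ℕ
  | _, .triv => 0
  | _, .inl x => pos x
  | _, .inr (l := l) y => l.numLeaves + pos y

/-- The leaf of `t` at position `i` (counted from left to right starting at `0`). -/
def leafAt : (t : PTree) → (i : ℕ) → i < t.numLeaves → Leaf t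
  | leaf, _, _ => .triv
  | node l r, i, h =>
    if hi : i < l.numLeaves then .inl (leafAt l i hi)
    else .inr (leafAt r (i - l.numLeaves) (by simp only [numLeaves] at h; omega))

/-- `graft x s`: graft the root of `s` onto the leaf `x` of `t`. -/
def graft : {t : PTree} → Leaf t → PTree → PTree
  | _, .triv, s => s
  | _, .inl (r := r) x, s => node (graft x s) r
  | _, .inr (l := l) y, s => node l (graft y s)

/-- The vertices of a grafting are those of the two trees. -/
def graftVert : {t : PTree} → (x : Leaf t) → (s : PTree) → Vert t ⊕ Vert s → Vert (graft x s)
  | .leaf, .triv, _, .inr v => v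
  | .node _ _, .inl _, _, .inl .root => .root
  | .node _ _, .inl x, s, .inl (.inl v) => .inl (graftVert x s (.inl v))
  | .node _ _, .inl _, _, .inl (.inr v) => .inr v
  | .node _ _, .inl x, s, .inr v => .inl (graftVert x s (.inr v))
  | .node _ _, .inr _, _, .inl .root => .root
  | .node _ _, .inr _, _, .inl (.inl v) => .inl v
  | .node _ _, .inr y, s, .inl (.inr v) => .inr (graftVert y s (.inl v))
  | .node _ _, .inr y, s, .inr v => .inr (graftVert y s (.inr v))

/-- The inverse of `graftVert`. -/
def ungraftVert : {t : PTree} → (x : Leaf t) → (s : PTree) → Vert (graft x s) → Vert t ⊕ Vert s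
  | .leaf, .triv, _, v => .inr v
  | .node l r, .inl x, s, v =>
    match (v : Vert (node (graft x s) r)) with
    | .root => .inl .root
    | .inl v => (ungraftVert x s v).map .inl id
    | .inr v => .inl (.inr v)
  | .node l r, .inr y, s, v =>
    match (v : Vert (node l (graft y s))) with
    | .root => .inl .root
    | .inl v => .inl (.inl v)
    | .inr v => (ungraftVert y s v).map .inr id

lemma ungraft_graft : ∀ {t : PTree} (x : Leaf t) (s : PTree) (v : Vert t ⊕ Vert s),
    ungraftVert x s (graftVert x s v) = v
  | .leaf, .triv, _, .inr v => rfl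
  | .node _ _, .inl _, _, .inl .root => rfl
  | .node _ _, .inl x, s, .inl (.inl v) =>
    congrArg (Sum.map Vert.inl id) (ungraft_graft x s (.inl v))
  | .node _ _, .inl _, _, .inl (.inr v) => rfl
  | .node _ _, .inl x, s, .inr v =>
    congrArg (Sum.map Vert.inl id) (ungraft_graft x s (.inr v))
  | .node _ _, .inr _, _, .inl .root => rfl
  | .node _ _, .inr _, _, .inl (.inl v) => rfl
  | .node _ _, .inr y, s, .inl (.inr v) =>
    congrArg (Sum.map Vert.inr id) (ungraft_graft y s (.inl v))
  | .node _ _, .inr y, s, .inr v =>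
    congrArg (Sum.map Vert.inr id) (ungraft_graft y s (.inr v))

lemma graft_ungraft : ∀ {t : PTree} (x : Leaf t) (s : PTree) (v : Vert (graft x s)),
    graftVert x s (ungraftVert x s v) = v
  | .leaf, .triv, _, v => rfl
  | .node l r, .inl x, s, v => by
    change Vert (node (graft x s) r) at v
    cases v with
    | root => rfl
    | inr v => rfl
    | inl v =>
      have h := graft_ungraft x s v
      change graftVert (.inl x) s ((ungraftVert x s v).map Vert.inl id) = _
      rcases hv : ungraftVert x s v with w | w <;> rw [hv] at h <;>
        exact congrArg (Vert.inl (l := graft x s) (r := r)) h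
  | .node l r, .inr y, s, v => by
    change Vert (node l (graft y s)) at v
    cases v with
    | root => rfl
    | inl v => rfl
    | inr v =>
      have h := graft_ungraft y s v
      change graftVert (.inr y) s ((ungraftVert y s v).map Vert.inr id) = _
      rcases hv : ungraftVert y s v with w | w <;> rw [hv] at h <;>
        exact congrArg (Vert.inr (l := l) (r := graft y s)) h

/-- The bijection between the vertices of two trees and the vertices of their grafting. -/
def graftVertEquiv {t : PTree} (x : Leaf t) (s : PTree) : Vert t ⊕ Vert s ≃ Vert (graft x s) where
  toFun := graftVert x s
  invFun := ungraftVert x s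
  left_inv := ungraft_graft x s
  right_inv := graft_ungraft x s

lemma numLeaves_graft : ∀ {t : PTree} (x : Leaf t) (s : PTree),
    (graft x s).numLeaves + 1 = t.numLeaves + s.numLeaves
  | _, .triv, s => by simp [graft, numLeaves, add_comm]
  | _, .inl x, s => by
    have := numLeaves_graft x s
    simp only [graft, numLeaves]; omega
  | _, .inr y, s => by
    have := numLeaves_graft y s
    simp only [graft, numLeaves]; omega

lemma pos_leafAt : ∀ (t : PTree) (i : ℕ) (h : i < t.numLeaves), (leafAt t i h).pos = i
  | leaf, i, h => by simp only [numLeaves] at h; simp only [leafAt, Leaf.pos]; omega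
  | node l r, i, h => by
    simp only [leafAt]
    split_ifs with hi
    · simp [Leaf.pos, pos_leafAt l i hi]
    · simp only [Leaf.pos, pos_leafAt r]; omega

end PTree

open PTree

/-! ### The free nonsymmetric operad on binary generators -/

section Free

variable (k : Type u) [Field k] (V : Type v) [AddCommGroup V] [Module k V]

/-- The treewise tensor module `t[V] = ⨂_{v ∈ Vert t} V`. -/
abbrev TreeTensor (t : PTree) : Type (max u v) := PiTensorProduct k (fun _ : Vert t => V)

/-- The space of arity `n` of the free nonsymmetric operad on a space `V` of binary operations:
the direct sum of `t[V]` over the planar binary trees `t` with `n` leaves. -/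
def FreeObj (n : ℕ) : Type (max u v) :=
  ⨁ t : {t : PTree // t.numLeaves = n}, TreeTensor k V t.1

instance (n : ℕ) : AddCommGroup (FreeObj k V n) :=
  inferInstanceAs (AddCommGroup (⨁ t : {t : PTree // t.numLeaves = n}, TreeTensor k V t.1))

instance (n : ℕ) : Module k (FreeObj k V n) :=
  inferInstanceAs (Module k (⨁ t : {t : PTree // t.numLeaves = n}, TreeTensor k V t.1))

namespace FreeObj

variable {V} {n : ℕ}

/-- The inclusion of the summand `t[V]`. -/
def incl (t : PTree) (ht : t.numLeaves = n) : TreeTensor k V t →ₗ[k] FreeObj k V n :=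
  DirectSum.lof k {t : PTree // t.numLeaves = n} (fun t => TreeTensor k V t.1) ⟨t, ht⟩

/-- The projection to the summand `t[V]`. -/
def proj (t : PTree) (ht : t.numLeaves = n) : FreeObj k V n →ₗ[k] TreeTensor k V t :=
  DirectSum.component k {t : PTree // t.numLeaves = n} (fun t => TreeTensor k V t.1) ⟨t, ht⟩

/-- The linear map given by linear maps on all summands `t[V]`. -/
def desc {M : Type w} [AddCommGroup M] [Module k M]
    (φ : ∀ t : PTree, t.numLeaves = n → TreeTensor k V t →ₗ[k] M) : FreeObj k V n →ₗ[k] M :=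
  DirectSum.toModule k {t : PTree // t.numLeaves = n} M fun t => φ t.1 t.2

lemma desc_incl {M : Type w} [AddCommGroup M] [Module k M]
    (φ : ∀ t : PTree, t.numLeaves = n → TreeTensor k V t →ₗ[k] M)
    (t : PTree) (ht : t.numLeaves = n) (x : TreeTensor k V t) :
    desc k φ (incl k t ht x) = φ t ht x :=
  DirectSum.toModule_lof (M := fun t : {t : PTree // t.numLeaves = n} => TreeTensor k V t.1)
    (φ := fun t => φ t.1 t.2) k ⟨t, ht⟩ x

lemma proj_incl (t : PTree) (ht : t.numLeaves = n) (x : TreeTensor k V t) :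
    proj k t ht (incl k t ht x) = x :=
  DirectSum.component.lof_self (M := fun t : {t : PTree // t.numLeaves = n} => TreeTensor k V t.1)
    k ⟨t, ht⟩ x

lemma proj_incl_of_ne (t s : PTree) (ht : t.numLeaves = n) (hs : s.numLeaves = n) (h : t ≠ s)
    (x : TreeTensor k V t) : proj k s hs (incl k t ht x) = 0 :=
  DirectSum.of_eq_of_ne (β := fun t : {t : PTree // t.numLeaves = n} => TreeTensor k V t.1)
    ⟨t, ht⟩ ⟨s, hs⟩ x (fun e => h (congrArg Subtype.val e).symm)

end FreeObj

/-- The map `t[V] ⊗ s[V] → (graft x s)[V]` that juxtaposes the decorations. -/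
def graftTensor {t : PTree} (x : Leaf t) (s : PTree) :
    TreeTensor k V t →ₗ[k] TreeTensor k V s →ₗ[k] TreeTensor k V (graft x s) :=
  (TensorProduct.mk k (TreeTensor k V t) (TreeTensor k V s)).compr₂
    ((PiTensorProduct.reindex k (fun _ => V) (graftVertEquiv x s)).toLinearMap ∘ₗ
      (PiTensorProduct.tmulEquiv k V).toLinearMap)

/-- Partial composition in the free nonsymmetric operad: grafting at the `i`-th leaf. -/
def freeComp {m n l : ℕ} (i : Fin m) (h : m + n = l + 1) :
    FreeObj k V m →ₗ[k] FreeObj k V n →ₗ[k] FreeObj k V l :=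
  FreeObj.desc k fun t ht => LinearMap.flip <| FreeObj.desc k fun s hs => LinearMap.flip <|
    (graftTensor k V (leafAt t i (by rw [ht]; exact i.2)) s).compr₂
      (FreeObj.incl k (graft (leafAt t i (by rw [ht]; exact i.2)) s) (by
        have := numLeaves_graft (leafAt t i (by rw [ht]; exact i.2)) s
        omega))

variable {V}

/-- A tree with vertices decorated by elements of `V`, as an element of the free operad. -/
def mono {n : ℕ} (t : PTree) (ht : t.numLeaves = n) (f : Vert t → V) : FreeObj k V n :=
  FreeObj.incl k t ht (PiTensorProduct.tprod k f)

lemma freeComp_mono {m n l : ℕ} (i : Fin m) (h : m + n = l + 1) (t s : PTree)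
    (ht : t.numLeaves = m) (hs : s.numLeaves = n) (f : Vert t → V) (g : Vert s → V) :
    freeComp k V i h (mono k t ht f) (mono k s hs g) =
      mono k (graft (leafAt t i (by rw [ht]; exact i.2)) s)
        (by have := numLeaves_graft (leafAt t i (by rw [ht]; exact i.2)) s; omega)
        (fun v => Sum.elim f g (ungraftVert _ s v)) := by
  simp only [freeComp, mono, FreeObj.desc_incl, LinearMap.flip_apply, graftTensor,
    LinearMap.compr₂_apply, TensorProduct.mk_apply, LinearMap.comp_apply,
    LinearEquiv.coe_coe, PiTensorProduct.tmulEquiv_apply, PiTensorProduct.reindex_tprod]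
  rfl

lemma free_induction {n : ℕ} {p : FreeObj k V n → Prop} (a : FreeObj k V n)
    (zero : p 0) (add : ∀ a b, p a → p b → p (a + b)) (smul : ∀ (c : k) a, p a → p (c • a))
    (mono : ∀ (t : PTree) (ht : t.numLeaves = n) (f : Vert t → V), p (mono k t ht f)) : p a := by
  have key : ∀ (t : PTree) (ht : t.numLeaves = n) (x : TreeTensor k V t),
      p (FreeObj.incl k t ht x) := by
    intro t ht x
    induction x using PiTensorProduct.induction_on with
    | smul_tprod c f =>
      rw [map_smul]
      exact smul c _ (mono t ht f)
    | add x y hx hy =>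
      rw [map_add]
      exact add _ _ hx hy
  exact DirectSum.induction_on (motive := p) a zero (fun t x => key t.1 t.2 x) add

/-- Auxiliary: decorated trees as an inductive type, used to compare decorated trees whose shapes
are only propositionally equal. -/
inductive DTree (V : Type v) : Type v
  | leaf : DTree V
  | node : DTree V → V → DTree V → DTree V

/-- Auxiliary: the decorated tree with given shape and decoration. -/
def decorate : (t : PTree) → (Vert t → V) → DTree V
  | .leaf, _ => .leaf
  | .node l r, f => .node (decorate l fun v => f (.inl v)) (f .root) (decorate r fun v => f (.inr v))

lemma decorate_inj : ∀ (t s : PTree) (f : Vert t → V) (g : Vert s → V),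
    decorate t f = decorate s g →
      (⟨t, f⟩ : Σ t : PTree, (Vert t → V)) = ⟨s, g⟩
  | .leaf, .leaf, f, g, _ => by
    congr 1
    funext v
    cases v
  | .leaf, .node _ _, f, g, h => by simp [decorate] at h
  | .node _ _, .leaf, f, g, h => by simp [decorate] at h
  | .node l r, .node l' r', f, g, h => by
    simp only [decorate, DTree.node.injEq] at h
    obtain ⟨h₁, h₂, h₃⟩ := h
    have e₁ := decorate_inj l l' _ _ h₁
    have e₃ := decorate_inj r r' _ _ h₃
    simp only [Sigma.mk.injEq] at e₁ e₃
    obtain ⟨rfl, e₁⟩ := e₁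
    obtain ⟨rfl, e₃⟩ := e₃
    congr 1
    funext v
    cases v with
    | root => exact h₂
    | inl v => exact congrFun (eq_of_heq e₁) v
    | inr v => exact congrFun (eq_of_heq e₃) v

lemma mono_congr {n : ℕ} {t s : PTree} (ht : t.numLeaves = n) (hs : s.numLeaves = n)
    {f : Vert t → V} {g : Vert s → V} (h : decorate t f = decorate s g) :
    mono k t ht f = mono k s hs g := by
  have e := decorate_inj t s f g h
  simp only [Sigma.mk.injEq] at e
  obtain ⟨rfl, e⟩ := e
  rw [eq_of_heq e]

namespace DTree

/-- Auxiliary: number of leaves of a decorated tree. -/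
def numLeaves : DTree V → ℕ
  | leaf => 1
  | node l _ r => numLeaves l + numLeaves r

/-- Auxiliary: grafting of decorated trees at a leaf position. -/
def graft : DTree V → ℕ → DTree V → DTree V
  | leaf, _, s => s
  | node l v r, i, s =>
    if i < l.numLeaves then node (graft l i s) v r else node l v (graft r (i - l.numLeaves) s)

lemma numLeaves_pos : ∀ t : DTree V, 0 < t.numLeaves
  | leaf => by simp [numLeaves]
  | node l _ r => by have := numLeaves_pos l; simp only [numLeaves]; omega

lemma numLeaves_graft : ∀ (t : DTree V) (i : ℕ) (s : DTree V),
    (graft t i s).numLeaves + 1 = t.numLeaves + s.numLeaves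
  | leaf, _, s => by simp [graft, numLeaves, add_comm]
  | node l v r, i, s => by
    have h₁ := numLeaves_graft l i s
    have h₂ := numLeaves_graft r (i - l.numLeaves) s
    simp only [graft]
    split_ifs <;> simp only [numLeaves] <;> omega

lemma graft_leaf : ∀ (t : DTree V) (i : ℕ), graft t i leaf = t
  | leaf, _ => rfl
  | node l v r, i => by simp [graft, graft_leaf l, graft_leaf r]

lemma graft_seq : ∀ (a : DTree V) (i : ℕ) (_ : i < a.numLeaves) (b : DTree V) (j : ℕ)
    (_ : j < b.numLeaves) (c : DTree V),
    graft (graft a i b) (i + j) c = graft a i (graft b j c)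
  | leaf, i, hi, b, j, hj, c => by
    have : i = 0 := by simp only [numLeaves] at hi; omega
    subst this
    simp [graft]
  | node l v r, i, hi, b, j, hj, c => by
    have h₁ := numLeaves_graft l i b
    simp only [numLeaves] at hi
    by_cases h : i < l.numLeaves
    · have h' : i + j < (graft l i b).numLeaves := by omega
      simp [graft, h, h', graft_seq l i h b j hj c]
    · have h' : ¬ (i + j < l.numLeaves) := by omega
      have e : i + j - l.numLeaves = i - l.numLeaves + j := by omega
      simp [graft, h, h', e, graft_seq r (i - l.numLeaves) (by omega) b j hj c]

lemma graft_par : ∀ (a : DTree V) (i j : ℕ) (_ : i < j) (_ : j < a.numLeaves) (b c : DTree V)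
    (q : ℕ) (_ : q + 1 = j + b.numLeaves),
    graft (graft a i b) q c = graft (graft a j c) i b
  | leaf, i, j, hij, hj, b, c, q, hq => by simp only [numLeaves] at hj; omega
  | node l v r, i, j, hij, hj, b, c, q, hq => by
    have h₁ := numLeaves_graft l i b
    have h₂ := numLeaves_graft l j c
    have hb := numLeaves_pos b
    have hc := numLeaves_pos c
    simp only [numLeaves] at hj
    by_cases h : j < l.numLeaves
    · have hi : i < l.numLeaves := by omega
      have hq' : q < (graft l i b).numLeaves := by omega
      have hi' : i < (graft l j c).numLeaves := by omega
      simp [graft, h, hi, hq', hi', graft_par l i j hij h b c q hq]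
    · by_cases hi : i < l.numLeaves
      · have hq' : ¬ q < (graft l i b).numLeaves := by omega
        have e : q - (graft l i b).numLeaves = j - l.numLeaves := by omega
        simp [graft, h, hi, hq', e]
      · have hq' : ¬ q < l.numLeaves := by omega
        simp [graft, h, hi, hq', graft_par r (i - l.numLeaves) (j - l.numLeaves) (by omega)
          (by omega) b c (q - l.numLeaves) (by omega)]

end DTree

lemma numLeaves_decorate : ∀ (t : PTree) (f : Vert t → V), (decorate t f).numLeaves = t.numLeaves
  | .leaf, _ => rfl
  | .node l r, f => by
    simp [decorate, DTree.numLeaves, PTree.numLeaves, numLeaves_decorate l, numLeaves_decorate r]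

lemma Leaf.pos_lt : ∀ {t : PTree} (x : Leaf t), x.pos < t.numLeaves
  | _, .triv => by simp [Leaf.pos, numLeaves]
  | _, .inl x => by have := pos_lt x; simp only [Leaf.pos, numLeaves]; omega
  | _, .inr y => by have := pos_lt y; simp only [Leaf.pos, numLeaves]; omega

lemma decorate_graft : ∀ {t : PTree} (x : Leaf t) (s : PTree) (f : Vert t → V) (g : Vert s → V),
    decorate (graft x s) (fun v => Sum.elim f g (ungraftVert x s v)) =
      (decorate t f).graft x.pos (decorate s g)
  | .leaf, .triv, s, f, g => rfl
  | .node l r, .inl x, s, f, g => by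
    have h := decorate_graft x s (fun v => f (.inl v)) g
    have hx := Leaf.pos_lt x
    simp only [decorate, DTree.graft, Leaf.pos, numLeaves_decorate, hx, if_true, ← h]
    change DTree.node _ _ _ = _
    congr 2
    funext v
    change Sum.elim f g ((ungraftVert x s v).map .inl id) = _
    rcases ungraftVert x s v with w | w <;> rfl
  | .node l r, .inr y, s, f, g => by
    have h := decorate_graft y s (fun v => f (.inr v)) g
    have hx : ¬ (l.numLeaves + y.pos < l.numLeaves) := by omega
    simp only [decorate, DTree.graft, Leaf.pos, numLeaves_decorate, hx, if_false,
      Nat.add_sub_cancel_left, ← h]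
    change DTree.node _ _ _ = _
    congr 2
    funext v
    change Sum.elim f g ((ungraftVert y s v).map .inr id) = _
    rcases ungraftVert y s v with w | w <;> rfl

variable (V)

/-- The unit of the free operad: the trivial tree. -/
def freeOne : FreeObj k V 1 := mono k .leaf numLeaves_leaf (fun v => nomatch v)

/-- The free nonsymmetric operad `T_ns(V)` on a space `V` of binary operations. -/
def free : NsOperad.{u, max u v} k where
  obj n := FreeObj k V n
  one := freeOne k V
  comp i h := freeComp k V i h
  one_comp {n} i h a := by
    induction a using free_induction k with
    | zero => simp
    | add a b ha hb => rw [map_add, ha, hb]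
    | smul c a ha => rw [map_smul, ha]
    | mono t ht f =>
      rw [freeOne, freeComp_mono]
      apply mono_congr
      rw [decorate_graft]
      rfl
  comp_one {n} i h a := by
    induction a using free_induction k with
    | zero => simp
    | add a b ha hb => rw [map_add, LinearMap.add_apply, ha, hb]
    | smul c a ha => rw [map_smul, LinearMap.smul_apply, ha]
    | mono t ht f =>
      rw [freeOne, freeComp_mono]
      apply mono_congr
      rw [decorate_graft]
      exact DTree.graft_leaf _ _
  comp_seq i j q hq h₁ h₂ h₃ h₄ a b c := by
    induction a using free_induction k with
    | zero => simp
    | add a a' ha hb => simp only [map_add, LinearMap.add_apply, ha, hb]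
    | smul x a ha => simp only [map_smul, LinearMap.smul_apply, ha]
    | mono t ht f =>
    induction b using free_induction k with
    | zero => simp
    | add a a' ha hb => simp only [map_add, LinearMap.add_apply, ha, hb]
    | smul x a ha => simp only [map_smul, LinearMap.smul_apply, ha]
    | mono t' ht' f' =>
    induction c using free_induction k with
    | zero => simp
    | add a a' ha hb => simp only [map_add, ha, hb]
    | smul x a ha => simp only [map_smul, ha]
    | mono t'' ht'' f'' =>
      simp only [freeComp_mono]
      apply mono_congr
      simp only [decorate_graft, pos_leafAt, hq]
      exact DTree.graft_seq _ _ (by rw [numLeaves_decorate, ht]; exact i.2) _ _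
        (by rw [numLeaves_decorate, ht']; exact j.2) _
  comp_par i j hij q i' hq hi h₁ h₂ h₃ h₄ a b c := by
    induction a using free_induction k with
    | zero => simp
    | add a a' ha hb => simp only [map_add, LinearMap.add_apply, ha, hb]
    | smul x a ha => simp only [map_smul, LinearMap.smul_apply, ha]
    | mono t ht f =>
    induction b using free_induction k with
    | zero => simp
    | add a a' ha hb => simp only [map_add, LinearMap.add_apply, ha, hb]
    | smul x a ha => simp only [map_smul, LinearMap.smul_apply, ha]
    | mono t' ht' f' =>
    induction c using free_induction k with
    | zero => simp
    | add a a' ha hb => simp only [map_add, LinearMap.add_apply, ha, hb]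
    | smul x a ha => simp only [map_smul, LinearMap.smul_apply, ha]
    | mono t'' ht'' f'' =>
      simp only [freeComp_mono]
      apply mono_congr
      simp only [decorate_graft, pos_leafAt, hi]
      exact DTree.graft_par _ _ _ hij (by rw [numLeaves_decorate, ht]; exact j.2) _ _ _
        (by rw [numLeaves_decorate, ht']; exact hq)

end Free

/-! ### Presented operads and the successor -/

/-- The two symbols `≺` and `≻`. -/
inductive Arrow : Type
  | prec : Arrow
  | succ : Arrow
  deriving DecidableEq

section Successor

variable (k : Type u) [Field k]

/-- The space `k≺ ⊕ k≻`. -/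
abbrev ArrowSpace : Type u := Arrow → k

/-- The basis vector `≺` of `k≺ ⊕ k≻`. -/
def vprec : ArrowSpace k := Pi.single .prec 1

/-- The basis vector `≻` of `k≺ ⊕ k≻`. -/
def vsucc : ArrowSpace k := Pi.single .succ 1

/-- The sum `⋆ = ≺ + ≻`. -/
def vstar : ArrowSpace k := vprec k + vsucc k

/-- The labels of the vertices in the constant decoration by `⋆`. -/
def starLabel (t : PTree) : Vert t → ArrowSpace k := fun _ => vstar k

/-- The second components of the labels of the bisuccessor of a tree with respect to the leaf `x`:
for `t = l ∨ r`, if `x` is a leaf of `l`, then the root gets `≺`, the vertices of `l` are labelled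
recursively and those of `r` get `⋆`; if `x` is a leaf of `r`, then the root gets `≻`, the vertices
of `l` get `⋆` and those of `r` are labelled recursively. -/
def suLabel : {t : PTree} → Leaf t → Vert t → ArrowSpace k
  | .node _ _, .inl _, .root => vprec k
  | .node _ _, .inl x, .inl v => suLabel x v
  | .node _ r, .inl _, .inr v => starLabel k r v
  | .node _ _, .inr _, .root => vsucc k
  | .node l _, .inr _, .inl v => starLabel k l v
  | .node _ _, .inr y, .inr v => suLabel y v

variable (V : Type v) [AddCommGroup V] [Module k V]

/-- The bisuccessor `Su_x`, for `x` the `i`-th leaf, as the linear map `T_ns(V)(n) → T_ns(Ṽ)(n)`,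
`Ṽ = V ⊗ (k≺ ⊕ k≻)`, that on each summand `t[V]` replaces the label `ω` of every vertex `v` by
`ω ⊗ (suLabel x v)`. -/
def su {n : ℕ} (i : Fin n) : FreeObj k V n →ₗ[k] FreeObj k (V ⊗[k] ArrowSpace k) n :=
  FreeObj.desc k fun t ht =>
    FreeObj.incl k t ht ∘ₗ PiTensorProduct.map fun v =>
      (TensorProduct.mk k V (ArrowSpace k)).flip (suLabel k (leafAt t i (by rw [ht]; exact i.2)) v)

end Successor

/-- A presentation of a binary nonsymmetric operad: a space of binary generating operations and, in
each arity, a space of relations in the free nonsymmetric operad. -/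
structure BinaryPresentation (k : Type u) [Field k] where
  gen : Type v
  [addCommGroup : AddCommGroup gen]
  [module : Module k gen]
  rel : ∀ n, Submodule k (FreeObj k gen n)

attribute [instance] BinaryPresentation.addCommGroup BinaryPresentation.module

namespace BinaryPresentation

variable {k : Type u} [Field k]

/-- The binary nonsymmetric operad `T_ns(V)/(R)`. -/
def operad (P : BinaryPresentation.{u, v} k) : NsOperad.{u, max u v} k :=
  (free k P.gen).quotient ((free k P.gen).idealSpan P.rel)

/-- A presentation is quadratic if all its relations lie in arity three, i.e. are combinations of
trees with two vertices. -/
def IsQuadratic (P : BinaryPresentation.{u, v} k) : Prop := ∀ n, n ≠ 3 → P.rel n = ⊥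

/-- The bisuccessor: generators `Ṽ = V ⊗ (k≺ ⊕ k≻)`, and relations spanned by all `Su_x(r)`, for `r`
a (homogeneous) relation and `x` a leaf. -/
def bisuccessor (P : BinaryPresentation.{u, v} k) : BinaryPresentation.{u, max u v} k where
  gen := P.gen ⊗[k] ArrowSpace k
  rel n := ⨆ i : Fin n, (P.rel n).map (su k P.gen i)

end BinaryPresentation

/-! ### The black square product and the dendriform operad -/

section BlackSquare

/-- The tree `(x y) z`. -/
def leftComb : PTree := .node (.node .leaf .leaf) .leaf

/-- The tree `x (y z)`. -/
def rightComb : PTree := .node .leaf (.node .leaf .leaf)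

lemma numLeaves_leftComb : leftComb.numLeaves = 3 := rfl

lemma numLeaves_rightComb : rightComb.numLeaves = 3 := rfl

variable (k : Type u) [Field k]

section

variable (V : Type v) [AddCommGroup V] [Module k V]

/-- The decoration of `(x y) z` with `a` at the root and `b` above it. -/
def leftLabel {V : Type v} (a b : V) : Vert leftComb → V
  | .root => a
  | .inl _ => b

/-- The decoration of `x (y z)` with `a` at the root and `b` above it. -/
def rightLabel {V : Type v} (a b : V) : Vert rightComb → V
  | .root => a
  | .inr _ => b

variable {V}

/-- The element `(x b y) a z` of `T_ns(V)(3)`. -/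
def leftMono (a b : V) : FreeObj k V 3 := mono k leftComb numLeaves_leftComb (leftLabel a b)

/-- The element `x a (y b z)` of `T_ns(V)(3)`. -/
def rightMono (a b : V) : FreeObj k V 3 := mono k rightComb numLeaves_rightComb (rightLabel a b)

end

variable (V : Type v) [AddCommGroup V] [Module k V] (W : Type w) [AddCommGroup W] [Module k W]

/-- The map `t[V] ⊗ t[W] → t[V ⊗ W]` that pairs the labels vertex by vertex, extended by zero to
`T_ns(V)(n) ⊗ T_ns(W)(n)`. -/
def pairAt {n : ℕ} (t : PTree) (ht : t.numLeaves = n) :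
    FreeObj k V n →ₗ[k] FreeObj k W n →ₗ[k] FreeObj k (V ⊗[k] W) n :=
  ((PiTensorProduct.map₂ fun _ : Vert t => TensorProduct.mk k V W).compl₁₂
      (FreeObj.proj k t ht) (FreeObj.proj k t ht)).compr₂ (FreeObj.incl k t ht)

/-- The map `Ψ : T_ns(V)(3) ⊗ T_ns(W)(3) → T_ns(V ⊗ W)(3)` defining the black square product:
`((x b y) a z) ⊗ ((x b' y) a' z) ↦ (x (b ⊗ b') y) (a ⊗ a') z`,
`(x a (y b z)) ⊗ (x a' (y b' z)) ↦ - x (a ⊗ a') (y (b ⊗ b') z)`,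
and the mixed terms go to zero. In other words a relation `Σ (x b y) a z = Σ x c (y d z)` paired
with a relation `Σ (x b' y) a' z = Σ x c' (y d' z)` gives the relation
`Σ (x (b ⊗ b') y) (a ⊗ a') z = Σ x (c ⊗ c') (y (d ⊗ d') z)`. -/
def blackPairing : FreeObj k V 3 →ₗ[k] FreeObj k W 3 →ₗ[k] FreeObj k (V ⊗[k] W) 3 :=
  pairAt k V W leftComb numLeaves_leftComb - pairAt k V W rightComb numLeaves_rightComb

end BlackSquare

namespace BinaryPresentation

variable {k : Type u} [Field k]

/-- The black square product `T_ns(V)/(R) ■ T_ns(W)/(S) = T_ns(V ⊗ W)/(Ψ(R ⊗ S))` of binary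
quadratic nonsymmetric operads. -/
def blackSquare (P : BinaryPresentation.{u, v} k) (Q : BinaryPresentation.{u, w} k) :
    BinaryPresentation.{u, max v w} k where
  gen := P.gen ⊗[k] Q.gen
  rel := Function.update (fun _ => ⊥) 3
    (Submodule.map₂ (blackPairing k P.gen Q.gen) (P.rel 3) (Q.rel 3))

variable (k)

/-- The dendriform operad: generated by `≺` and `≻`, with the relations
`(x ≺ y) ≺ z = x ≺ (y ⋆ z)`, `(x ≻ y) ≺ z = x ≻ (y ≺ z)`, `(x ⋆ y) ≻ z = x ≻ (y ≻ z)`,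
where `⋆ = ≺ + ≻`. -/
def dend : BinaryPresentation.{u, u} k where
  gen := ArrowSpace k
  rel := Function.update (fun _ => ⊥) 3 <| Submodule.span k
    {leftMono k (vprec k) (vprec k) - rightMono k (vprec k) (vstar k),
      leftMono k (vprec k) (vsucc k) - rightMono k (vsucc k) (vprec k),
      leftMono k (vsucc k) (vstar k) - rightMono k (vsucc k) (vsucc k)}

end BinaryPresentation

end NSOp

end

/-!
The flip `V ⊗ (k≺ ⊕ k≻) ≃ (k≺ ⊕ k≻) ⊗ V` of the generators induces an isomorphism of free operads,
and this isomorphism carries the relations of `Su(P)` onto those of `Dend ■ P`.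

Indeed, the `i`-th defining relation `dᵢ` of `Dend` is the difference `Lᵢ - Rᵢ` of a left comb and
a right comb, whose labels are exactly the arrows that `Su_x`, for `x` the `i`-th leaf, puts on the
vertices of these two trees. The sign in `Ψ` cancels the sign in `dᵢ`, so that `Ψ(dᵢ ⊗ r)` is
`Su_x(r)` up to the flip, for every `r` of arity three (`blackPairing_dendRel`). As the `dᵢ` span
the relations of `Dend`, the two spaces of relations correspond in arity three
(`map_rel_bisuccessor`); in all other arities both vanish, since `P` is quadratic.

What remains is formal: an isomorphism of operads that matches two families of subspaces matches
the ideals they generate, and hence descends to the quotients (`NsOperad.Iso.quotient`).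
-/

namespace NSOp

universe u v w

noncomputable section

/-! ### Isomorphisms of operads and quotients -/

namespace NsOperad

variable {k : Type u} [Field k] {P : NsOperad.{u, v} k} {Q : NsOperad.{u, w} k}

/-- The inverse of an isomorphism of nonsymmetric operads. -/
def Iso.symm (e : P.Iso Q) : Q.Iso P where
  equiv n := (e.equiv n).symm
  map_one := by rw [LinearEquiv.symm_apply_eq, e.map_one]
  map_comp i h a b := by simp [LinearEquiv.symm_apply_eq, e.map_comp]

/-- The preimage of an operadic ideal under an isomorphism. -/
def Ideal.comap (e : P.Iso Q) (J : Q.Ideal) : P.Ideal where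
  carrier n := (J.carrier n).comap (e.equiv n : P.obj n →ₗ[k] Q.obj n)
  comp_left_mem i h a b ha := by
    simpa [e.map_comp] using J.comp_left_mem i h _ (e.equiv _ b) ha
  comp_right_mem i h a b hb := by
    simpa [e.map_comp] using J.comp_right_mem i h (e.equiv _ a) _ hb

lemma subset_idealSpan (R : ∀ n, Submodule k (P.obj n)) (n : ℕ) :
    R n ≤ (P.idealSpan R).carrier n :=
  le_iInf fun J => J.2 n

lemma idealSpan_le {R : ∀ n, Submodule k (P.obj n)} (J : P.Ideal)
    (h : ∀ n, R n ≤ J.carrier n) (n : ℕ) : (P.idealSpan R).carrier n ≤ J.carrier n :=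
  iInf_le (fun J : {J : P.Ideal // ∀ m, R m ≤ J.carrier m} => J.1.carrier n) ⟨J, h⟩

lemma map_idealSpan_le (e : P.Iso Q) {R : ∀ n, Submodule k (P.obj n)}
    {S : ∀ n, Submodule k (Q.obj n)}
    (h : ∀ n, (R n).map (e.equiv n : P.obj n →ₗ[k] Q.obj n) ≤ S n) (n : ℕ) :
    ((P.idealSpan R).carrier n).map (e.equiv n : P.obj n →ₗ[k] Q.obj n) ≤
      (Q.idealSpan S).carrier n :=
  Submodule.map_le_iff_le_comap.2 <| idealSpan_le ((Q.idealSpan S).comap e)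
    (fun m => Submodule.map_le_iff_le_comap.1 ((h m).trans (subset_idealSpan S m))) n

lemma map_idealSpan (e : P.Iso Q) {R : ∀ n, Submodule k (P.obj n)}
    {S : ∀ n, Submodule k (Q.obj n)}
    (h : ∀ n, (R n).map (e.equiv n : P.obj n →ₗ[k] Q.obj n) = S n) (n : ℕ) :
    ((P.idealSpan R).carrier n).map (e.equiv n : P.obj n →ₗ[k] Q.obj n) =
      (Q.idealSpan S).carrier n := by
  refine le_antisymm (map_idealSpan_le e (fun m => (h m).le) n) fun y hy => ?_
  have h' : ∀ m, (S m).map (e.symm.equiv m : Q.obj m →ₗ[k] P.obj m) ≤ R m := by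
    rintro m _ ⟨_, hx, rfl⟩
    rw [← h m] at hx
    obtain ⟨x, hx, rfl⟩ := hx
    simpa [Iso.symm] using hx
  exact ⟨(e.equiv n).symm y, map_idealSpan_le e.symm h' n ⟨y, hy, rfl⟩, by simp⟩

/-- An isomorphism of operads that carries one ideal onto another descends to the quotients. -/
def Iso.quotient (e : P.Iso Q) (I : P.Ideal) (J : Q.Ideal)
    (h : ∀ n, (I.carrier n).map (e.equiv n : P.obj n →ₗ[k] Q.obj n) = J.carrier n) :
    (P.quotient I).Iso (Q.quotient J) where
  equiv n := Submodule.Quotient.equiv (I.carrier n) (J.carrier n) (e.equiv n) (h n)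
  map_one := congrArg Submodule.Quotient.mk e.map_one
  map_comp i _ a b := by
    obtain ⟨a, rfl⟩ := Submodule.Quotient.mk_surjective _ a
    obtain ⟨b, rfl⟩ := Submodule.Quotient.mk_surjective _ b
    exact congrArg Submodule.Quotient.mk (e.map_comp i _ a b)

end NsOperad

/-! ### Functoriality of the free operad -/

open PTree

section Functoriality

variable (k : Type u) [Field k] {V : Type v} [AddCommGroup V] [Module k V]
  {W : Type w} [AddCommGroup W] [Module k W]

/-- The map of free operads that applies a linear map `V → W` to all labels. -/
def freeMap (φ : V →ₗ[k] W) (n : ℕ) : FreeObj k V n →ₗ[k] FreeObj k W n :=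
  FreeObj.desc k fun t ht => FreeObj.incl k t ht ∘ₗ PiTensorProduct.map fun _ => φ

lemma freeMap_mono (φ : V →ₗ[k] W) {n : ℕ} (t : PTree) (ht : t.numLeaves = n) (f : Vert t → V) :
    freeMap k φ n (mono k t ht f) = mono k t ht fun v => φ (f v) := by
  simp [freeMap, mono, FreeObj.desc_incl, PiTensorProduct.map_tprod]

lemma freeMap_freeMap_of_leftInverse (φ : V →ₗ[k] W) (ψ : W →ₗ[k] V)
    (h : Function.LeftInverse ψ φ) {n : ℕ} (a : FreeObj k V n) :
    freeMap k ψ n (freeMap k φ n a) = a := by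
  induction a using free_induction k with
  | zero => simp
  | add a b ha hb => simp only [map_add, ha, hb]
  | smul c a ha => simp only [map_smul, ha]
  | mono t ht f => simp only [freeMap_mono, h _]

lemma freeMap_comp (φ : V →ₗ[k] W) {m n l : ℕ} (i : Fin m) (h : m + n = l + 1)
    (a : FreeObj k V m) (b : FreeObj k V n) :
    freeMap k φ l (freeComp k V i h a b) =
      freeComp k W i h (freeMap k φ m a) (freeMap k φ n b) := by
  induction a using free_induction k with
  | zero => simp
  | add a a' ha ha' => simp only [map_add, LinearMap.add_apply, ha, ha']
  | smul c a ha => simp only [map_smul, LinearMap.smul_apply, ha]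
  | mono t ht f =>
  induction b using free_induction k with
  | zero => simp
  | add b b' hb hb' => simp only [map_add, hb, hb']
  | smul c b hb => simp only [map_smul, hb]
  | mono s hs g =>
    simp only [freeComp_mono, freeMap_mono]
    congr 1
    funext v
    rcases ungraftVert _ s v with w | w <;> rfl

/-- The isomorphism of free operads induced by an isomorphism of their generators. -/
def freeIso (φ : V ≃ₗ[k] W) : (free k V).Iso (free k W) where
  equiv n := LinearEquiv.ofLinearMap (freeMap k (φ : V →ₗ[k] W) n) (freeMap k (φ.symm : W →ₗ[k] V) n)
    (LinearMap.ext fun a => freeMap_freeMap_of_leftInverse k _ _ φ.apply_symm_apply a)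
    (LinearMap.ext fun a => freeMap_freeMap_of_leftInverse k _ _ φ.symm_apply_apply a)
  map_one := (freeMap_mono k _ _ _ _).trans (congrArg _ (funext fun v => nomatch v))
  map_comp i h a b := freeMap_comp k _ i h a b

end Functoriality

/-! ### Pairing with the dendriform relations -/

lemma PTree.one_le_numLeaves : ∀ t : PTree, 1 ≤ t.numLeaves
  | .leaf => le_rfl
  | .node l _ => (one_le_numLeaves l).trans (Nat.le_add_right _ _)

lemma PTree.eq_leaf_of_numLeaves : ∀ {t : PTree}, t.numLeaves = 1 → t = .leaf
  | .leaf, _ => rfl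
  | .node l r, h => by
    have := one_le_numLeaves l
    have := one_le_numLeaves r
    simp only [numLeaves] at h
    omega

lemma PTree.eq_cherry_of_numLeaves : ∀ {t : PTree}, t.numLeaves = 2 → t = .node .leaf .leaf
  | .leaf, h => by simp [numLeaves] at h
  | .node l r, h => by
    have := one_le_numLeaves l
    have := one_le_numLeaves r
    simp only [numLeaves] at h
    rw [eq_leaf_of_numLeaves (t := l) (by omega), eq_leaf_of_numLeaves (t := r) (by omega)]

lemma PTree.eq_comb_of_numLeaves : ∀ {t : PTree}, t.numLeaves = 3 → t = leftComb ∨ t = rightComb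
  | .leaf, h => by simp [numLeaves] at h
  | .node l r, h => by
    have := one_le_numLeaves l
    have := one_le_numLeaves r
    simp only [numLeaves] at h
    obtain hl | hl : l.numLeaves = 1 ∨ l.numLeaves = 2 := by omega
    · right
      rw [eq_leaf_of_numLeaves hl, eq_cherry_of_numLeaves (t := r) (by omega), rightComb]
    · left
      rw [eq_cherry_of_numLeaves hl, eq_leaf_of_numLeaves (t := r) (by omega), leftComb]

section Pairing

variable (k : Type u) [Field k] (V : Type v) [AddCommGroup V] [Module k V]
  (W : Type w) [AddCommGroup W] [Module k W]

lemma pairAt_mono {n : ℕ} (t : PTree) (ht : t.numLeaves = n) (f : Vert t → V) (g : Vert t → W) :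
    pairAt k V W t ht (mono k t ht f) (mono k t ht g) = mono k t ht fun v => f v ⊗ₜ[k] g v := by
  simp [pairAt, mono, FreeObj.proj_incl, PiTensorProduct.map₂_tprod_tprod]

lemma pairAt_mono_left_of_ne {n : ℕ} {t s : PTree} (ht : t.numLeaves = n) (hs : s.numLeaves = n)
    (h : s ≠ t) (f : Vert s → V) (b : FreeObj k W n) :
    pairAt k V W t ht (mono k s hs f) b = 0 := by
  simp [pairAt, mono, FreeObj.proj_incl_of_ne k s t hs ht h]

lemma pairAt_mono_right_of_ne {n : ℕ} {t s : PTree} (ht : t.numLeaves = n) (hs : s.numLeaves = n)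
    (h : s ≠ t) (a : FreeObj k V n) (g : Vert s → W) :
    pairAt k V W t ht a (mono k s hs g) = 0 := by
  simp [pairAt, mono, FreeObj.proj_incl_of_ne k s t hs ht h]

lemma leftComb_ne_rightComb : leftComb ≠ rightComb := by decide

/-- The `i`-th dendriform relation: the difference of the left comb and the right comb, each
labelled as in the bisuccessor with respect to the `i`-th leaf. -/
def dendRel (i : Fin 3) : FreeObj k (ArrowSpace k) 3 :=
  mono k leftComb numLeaves_leftComb (suLabel k (leafAt leftComb i i.2)) -
    mono k rightComb numLeaves_rightComb (suLabel k (leafAt rightComb i i.2))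

lemma dend_rel_three :
    (BinaryPresentation.dend k).rel 3 = ⨆ i : Fin 3, Submodule.span k {dendRel k i} := by
  have hL : ∀ (i : Fin 3) (a b : ArrowSpace k),
      suLabel k (leafAt leftComb i i.2) .root = a →
      suLabel k (leafAt leftComb i i.2) (.inl .root) = b →
      leftMono k a b = mono k leftComb numLeaves_leftComb (suLabel k (leafAt leftComb i i.2)) := by
    rintro i a b rfl rfl
    refine congrArg (mono k leftComb _) (funext fun v => ?_)
    match v with
    | .root => rfl
    | .inl .root => rfl
  have hR : ∀ (i : Fin 3) (a b : ArrowSpace k),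
      suLabel k (leafAt rightComb i i.2) .root = a →
      suLabel k (leafAt rightComb i i.2) (.inr .root) = b →
      rightMono k a b =
        mono k rightComb numLeaves_rightComb (suLabel k (leafAt rightComb i i.2)) := by
    rintro i a b rfl rfl
    refine congrArg (mono k rightComb _) (funext fun v => ?_)
    match v with
    | .root => rfl
    | .inr .root => rfl
  have h₀ : leftMono k (vprec k) (vprec k) - rightMono k (vprec k) (vstar k) = dendRel k 0 :=
    congrArg₂ _ (hL 0 _ _ rfl rfl) (hR 0 _ _ rfl rfl)
  have h₁ : leftMono k (vprec k) (vsucc k) - rightMono k (vsucc k) (vprec k) = dendRel k 1 :=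
    congrArg₂ _ (hL 1 _ _ rfl rfl) (hR 1 _ _ rfl rfl)
  have h₂ : leftMono k (vsucc k) (vstar k) - rightMono k (vsucc k) (vsucc k) = dendRel k 2 :=
    congrArg₂ _ (hL 2 _ _ rfl rfl) (hR 2 _ _ rfl rfl)
  change (Function.update (fun _ => ⊥) 3 (Submodule.span k {_, _, _}) :
    ∀ n, Submodule k (FreeObj k (ArrowSpace k) n)) 3 = _
  rw [Function.update_self, h₀, h₁, h₂, ← Submodule.span_iUnion]
  congr 1
  ext x
  simp [Fin.exists_fin_succ, eq_comm]

lemma su_mono {n : ℕ} (i : Fin n) (t : PTree) (ht : t.numLeaves = n) (f : Vert t → V) :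
    su k V i (mono k t ht f) =
      mono k t ht fun v => f v ⊗ₜ[k] suLabel k (leafAt t i (ht ▸ i.2)) v := by
  simp [su, mono, FreeObj.desc_incl, PiTensorProduct.map_tprod]

/-- Pairing with the `i`-th dendriform relation is, up to the flip of the labels, the bisuccessor
with respect to the `i`-th leaf. -/
lemma blackPairing_dendRel (i : Fin 3) (r : FreeObj k V 3) :
    blackPairing k (ArrowSpace k) V (dendRel k i) r =
      freeMap k (TensorProduct.comm k V (ArrowSpace k) :
        V ⊗[k] ArrowSpace k →ₗ[k] ArrowSpace k ⊗[k] V) 3 (su k V i r) := by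
  induction r using free_induction k with
  | zero => simp
  | add a b ha hb => simp only [map_add, ha, hb]
  | smul c a ha => simp only [map_smul, ha]
  | mono t ht f =>
    rw [su_mono, freeMap_mono]
    obtain rfl | rfl := eq_comb_of_numLeaves ht
    · simp [blackPairing, dendRel, pairAt_mono,
        pairAt_mono_left_of_ne k _ _ _ _ leftComb_ne_rightComb.symm,
        pairAt_mono_right_of_ne k _ _ _ _ leftComb_ne_rightComb]
    · simp [blackPairing, dendRel, pairAt_mono,
        pairAt_mono_left_of_ne k _ _ _ _ leftComb_ne_rightComb,
        pairAt_mono_right_of_ne k _ _ _ _ leftComb_ne_rightComb.symm]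

end Pairing

/-- The flip of the generators carries the relations of `Su(P)` onto those of `Dend ■ P`. -/
lemma map_rel_bisuccessor {k : Type u} [Field k] (P : BinaryPresentation.{u, v} k)
    (hP : P.IsQuadratic) (n : ℕ) :
    (P.bisuccessor.rel n).map (freeMap k (TensorProduct.comm k P.gen (ArrowSpace k) :
        P.gen ⊗[k] ArrowSpace k →ₗ[k] ArrowSpace k ⊗[k] P.gen) n) =
      ((BinaryPresentation.dend k).blackSquare P).rel n := by
  change Submodule.map _ (⨆ i : Fin n, (P.rel n).map (su k P.gen i)) =
    (Function.update (fun _ => ⊥) 3 (Submodule.map₂ (blackPairing k (ArrowSpace k) P.gen)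
      ((BinaryPresentation.dend k).rel 3) (P.rel 3)) :
        ∀ n, Submodule k (FreeObj k (ArrowSpace k ⊗[k] P.gen) n)) n
  by_cases hn : n = 3
  · subst hn
    rw [Function.update_self, dend_rel_three, Submodule.map_iSup, Submodule.map₂_iSup_left]
    refine iSup_congr fun i => ?_
    rw [Submodule.map₂_span_singleton_eq_map, ← Submodule.map_comp]
    exact congrArg (fun φ => Submodule.map φ (P.rel 3))
      (LinearMap.ext fun r => (blackPairing_dendRel k P.gen i r).symm)
  · rw [Function.update_of_ne hn, hP n hn]
    simp

end

end NSOp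

theorem theorem3p3 {k : Type*} [Field k] (P : NSOp.BinaryPresentation k) (hP : P.IsQuadratic) :
    Nonempty (NSOp.NsOperad.Iso P.bisuccessor.operad
      (NSOp.BinaryPresentation.blackSquare (NSOp.BinaryPresentation.dend k) P).operad) :=
  ⟨(NSOp.freeIso k (TensorProduct.comm k P.gen (NSOp.ArrowSpace k))).quotient _ _
    (NSOp.NsOperad.map_idealSpan _ (NSOp.map_rel_bisuccessor P hP))⟩
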